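/- A pseudocompact Hausdorff abelian topological group $(G,\tau)$ is $ss$-characterized if and only if $G$ is finite. Here $(G,\tau)$ is pseudocompact if every continuous function $G\to\mathbb{R}$ is bounded. A precompact group topology on an abelian group $G$ is a Hausdorff group topology such that for every neighbourhood $U$ of $0$ there is a finite set $F\subseteq G$ with $F+U=G$. The group $(G,\tau)$ is called $ss$-characterized (single sequence characterized) if there is a sequence $(u_n)_{n\in\mathbb{N}}$ in $G$ such that $\tau$ is the finest precompact group topology on $G$ in which $u_n\to 0$; that is, $\tau$ is a precompact group topology, $u_n\to 0$ in $\tau$, and every precompact group topology on $G$ in which $u_n\to 0$ is coarser than or equal to $\tau$. -/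

import Mathlib

open Filter Topology
open scoped Pointwise

/-- A space is pseudocompact if every continuous real-valued function on it is bounded. -/
def IsPseudocompact (X : Type*) [TopologicalSpace X] : Prop :=
  ∀ f : X → ℝ, Continuous f → ∃ M : ℝ, ∀ x : X, |f x| ≤ M

/-- A precompact group topology on an abelian group: a Hausdorff group topology that is totally
bounded, i.e. finitely many translates of each neighbourhood of `0` cover the group. -/
structure IsPrecompactGroupTopology {G : Type*} [AddCommGroup G]
    (τ : TopologicalSpace G) : Prop where
  isTopologicalAddGroup : @IsTopologicalAddGroup G τ _
  t2Space : @T2Space G τ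
  exists_finite_cover :
    ∀ U ∈ @nhds G τ (0 : G), ∃ F : Set G, F.Finite ∧ F + U = Set.univ

/-- The sequence `u` characterizes `τ`: `τ` is the finest precompact group topology in which `u`
converges to `0`. In Mathlib's order on topologies `τ ≤ σ` says that `τ` is finer than `σ`. -/
def Characterizes {G : Type*} [AddCommGroup G] (u : ℕ → G) (τ : TopologicalSpace G) : Prop :=
  IsPrecompactGroupTopology τ ∧ Tendsto u atTop (@nhds G τ (0 : G)) ∧
    ∀ σ : TopologicalSpace G, IsPrecompactGroupTopology σ →
      Tendsto u atTop (@nhds G σ (0 : G)) → τ ≤ σ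

/-- A topological abelian group is single sequence characterized if some sequence of its elements
characterizes its topology (in particular its topology is then precompact). -/
def IsSSCharacterized (G : Type*) [AddCommGroup G] [τ : TopologicalSpace G] : Prop :=
  ∃ u : ℕ → G, Characterizes u τ

/-! Refining `τ` by a homomorphism into a compact group that kills `u` preserves precompactness and
`u → 0`, so maximality makes that homomorphism continuous. Let `H` be the subgroup generated by `u`.
If `G ⧸ H` were infinite, it would have a countably infinite image, which characters embed in a
power of the circle. This image would be a countable pseudocompact group, hence finite by a Baire
category argument. So `H`, which is countable, has finite index; `G` is then countable, hence
finite. -/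

/-- A countable completely regular Hausdorff pseudocompact nonempty space has an isolated point. -/
theorem IsPseudocompact.exists_isOpen_singleton {X : Type*} [TopologicalSpace X]
    [CompletelyRegularSpace X] [T1Space X] [Countable X] [Nonempty X] (hX : IsPseudocompact X) :
    ∃ x : X, IsOpen ({x} : Set X) := by
  have hsep : ∀ p : X × X, ∃ f : X → ℝ, Continuous f ∧ (p.1 ≠ p.2 → f p.1 ≠ f p.2) := by
    rintro ⟨x, y⟩
    by_cases h : x = y
    · exact ⟨fun _ => 0, continuous_const, fun h' => absurd h h'⟩
    · obtain ⟨f, hf, hfx, hfy⟩ :=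
        CompletelyRegularSpace.completely_regular x {y} isClosed_singleton (by simpa using h)
      refine ⟨fun z => f z, by fun_prop, fun _ => ?_⟩
      have := hfy (Set.mem_singleton y)
      simp [hfx, this]
  choose f hfc hf using hsep
  let Φ : X → X × X → ℝ := fun x p => f p x
  have hΦ : Continuous Φ := continuous_pi hfc
  have hinj : Function.Injective Φ := fun x y hxy => by
    by_contra h
    exact hf (x, y) h (congrFun hxy (x, y))
  -- A countable product of lines is completely metrizable.
  let := TopologicalSpace.upgradeIsCompletelyMetrizable (X × X → ℝ)
  -- If `y` were a limit point outside the range, `1 / dist (Φ x) y` would be continuous and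
  -- unbounded.
  have hclosed : IsClosed (Set.range Φ) := by
    by_contra hcl
    obtain ⟨y, hy, hyn⟩ : ∃ y ∈ closure (Set.range Φ), y ∉ Set.range Φ := by
      by_contra! h
      exact hcl (isClosed_of_closure_subset h)
    have hpos : ∀ x, 0 < dist (Φ x) y := fun x => dist_pos.2 fun h => hyn ⟨x, h⟩
    obtain ⟨M, hM⟩ := hX (fun x => (dist (Φ x) y)⁻¹)
      ((hΦ.dist continuous_const).inv₀ fun x => (hpos x).ne')
    have hM0 : 0 < M := by
      obtain ⟨x⟩ := ‹Nonempty X›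
      exact (inv_pos.2 (hpos x)).trans_le ((le_abs_self _).trans (hM x))
    obtain ⟨_, ⟨x, rfl⟩, hx⟩ := Metric.mem_closure_iff.1 hy M⁻¹ (inv_pos.2 hM0)
    rw [dist_comm] at hx
    have h1 := (le_abs_self _).trans (hM x)
    have h2 := (inv_lt_inv₀ (inv_pos.2 hM0) (hpos x)).2 hx
    rw [inv_inv] at h2
    linarith
  have : CompleteSpace (Set.range Φ) := hclosed.isComplete.completeSpace_coe
  have : Countable (Set.range Φ) := (Set.countable_range Φ).to_subtype
  have : Nonempty (Set.range Φ) := Set.instNonemptyRange Φ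
  -- Baire: a countable union of closed points fills the space, so one of them has interior.
  obtain ⟨y, z, hz⟩ := nonempty_interior_of_iUnion_of_closed
    (f := fun y : Set.range Φ => ({y} : Set (Set.range Φ))) (fun _ => isClosed_singleton)
    (Set.iUnion_of_singleton _)
  have hopen : IsOpen ({y} : Set (Set.range Φ)) := by
    have : interior ({y} : Set (Set.range Φ)) = {y} :=
      Set.Subset.antisymm interior_subset fun w hw => by
        have h := interior_subset hz
        rw [Set.mem_singleton_iff] at h hw
        exact hw.trans h.symm ▸ hz
    exact this ▸ isOpen_interior
  obtain ⟨_, x, rfl⟩ := y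
  refine ⟨x, ?_⟩
  have := hopen.preimage (hΦ.subtype_mk fun w => Set.mem_range_self w)
  convert this using 1
  ext w
  simp [Subtype.ext_iff, hinj.eq_iff]

theorem IsPseudocompact.finite_of_discreteTopology {X : Type*} [TopologicalSpace X]
    [DiscreteTopology X] (hX : IsPseudocompact X) : Finite X := by
  by_contra h
  rw [not_finite_iff_infinite] at h
  let e := Infinite.natEmbedding X
  obtain ⟨M, hM⟩ := hX (fun x => ((Function.invFun e x : ℕ) : ℝ)) continuous_of_discreteTopology
  obtain ⟨n, hn⟩ := exists_nat_gt M
  have := (le_abs_self _).trans (hM (e n))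
  rw [Function.leftInverse_invFun e.injective n] at this
  linarith

/-- A countable pseudocompact Hausdorff abelian topological group is finite. -/
theorem IsPseudocompact.finite_of_countable {G : Type*} [AddCommGroup G] [TopologicalSpace G]
    [IsTopologicalAddGroup G] [T2Space G] [Countable G] (hG : IsPseudocompact G) : Finite G := by
  let := IsTopologicalAddGroup.rightUniformSpace G
  obtain ⟨x, hx⟩ := hG.exists_isOpen_singleton
  have : DiscreteTopology G := by
    refine discreteTopology_of_isOpen_singleton_zero ?_
    have := hx.preimage (continuous_const_add x)
    convert this using 1
    ext y
    simp
  exact hG.finite_of_discreteTopology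

theorem IsPseudocompact.of_surjective {X Y : Type*} [TopologicalSpace X] [TopologicalSpace Y]
    (hX : IsPseudocompact X) {f : X → Y} (hf : Continuous f) (hs : Function.Surjective f) :
    IsPseudocompact Y := fun g hg => by
  obtain ⟨M, hM⟩ := hX (g ∘ f) (hg.comp hf)
  refine ⟨M, fun y => ?_⟩
  obtain ⟨x, rfl⟩ := hs y
  exact hM x

/-- Refining a precompact group topology by a homomorphism into a compact group keeps it
precompact. -/
theorem IsPrecompactGroupTopology.inf_induced {G K : Type*} [AddCommGroup G] [AddCommGroup K]
    [TopologicalSpace K] [IsTopologicalAddGroup K] [CompactSpace K] {τ : TopologicalSpace G}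
    (hτ : IsPrecompactGroupTopology τ) (f : G →+ K) :
    IsPrecompactGroupTopology (τ ⊓ TopologicalSpace.induced f inferInstance) := by
  have := hτ.isTopologicalAddGroup
  refine ⟨topologicalAddGroup_inf hτ.isTopologicalAddGroup (topologicalAddGroup_induced f),
    t2Space_antitone inf_le_left hτ.t2Space, fun U hU => ?_⟩
  rw [nhds_inf, nhds_induced, map_zero] at hU
  obtain ⟨V, hV, W, hW, rfl⟩ := Filter.mem_inf_iff.1 hU
  obtain ⟨W, hW', hWW⟩ := hW
  obtain ⟨V₁, hV₁, hV₁V⟩ := exists_nhds_half_neg hV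
  obtain ⟨W₁, hW₁, hW₁W⟩ := exists_nhds_half_neg hW'
  obtain ⟨F, hF, hFV⟩ := hτ.exists_finite_cover V₁ hV₁
  obtain ⟨t, ht⟩ := compact_covered_by_add_left_translates (isCompact_univ (X := K))
    (V := W₁) ⟨0, mem_interior_iff_mem_nhds.2 hW₁⟩
  -- The centres in `K` need not lie in the image of `f`, so each nonempty cell gets a
  -- representative in `G`; differences within a cell are small for both topologies.
  have hc : ∀ p : G × K, ∃ c : G, (∃ x, x - p.1 ∈ V₁ ∧ p.2 + f x ∈ W₁) →
      c - p.1 ∈ V₁ ∧ p.2 + f c ∈ W₁ := fun p => by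
    by_cases h : ∃ x, x - p.1 ∈ V₁ ∧ p.2 + f x ∈ W₁
    · exact ⟨h.choose, fun _ => h.choose_spec⟩
    · exact ⟨0, fun h' => absurd h' h⟩
  choose c hc using hc
  refine ⟨c '' (F ×ˢ (t : Set K)), (hF.prod t.finite_toSet).image c,
    Set.eq_univ_of_forall fun x => ?_⟩
  obtain ⟨a, ha, v, hv, hav⟩ := Set.mem_add.1 (hFV ▸ Set.mem_univ x)
  obtain ⟨b, hb, hbx⟩ := Set.mem_iUnion₂.1 (ht (Set.mem_univ (f x)))
  have hx : x - a ∈ V₁ := by rwa [← hav, add_sub_cancel_left]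
  obtain ⟨h1, h2⟩ := hc (a, b) ⟨x, hx, hbx⟩
  refine Set.mem_add.2 ⟨c (a, b), ⟨(a, b), ⟨ha, hb⟩, rfl⟩, x - c (a, b), ⟨?_, hWW ?_⟩,
    add_sub_cancel _ _⟩
  · simpa using hV₁V _ hx _ h1
  · simpa using hW₁W _ hbx _ h2

/-- Homomorphisms into compact groups that kill a characterizing sequence are continuous. -/
theorem Characterizes.continuous_of_forall_eq_zero {G K : Type*} [AddCommGroup G] [AddCommGroup K]
    [TopologicalSpace K] [IsTopologicalAddGroup K] [CompactSpace K] [τ : TopologicalSpace G]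
    {u : ℕ → G} (hu : Characterizes u τ) (f : G →+ K) (hf : ∀ n, f (u n) = 0) : Continuous f := by
  rw [continuous_iff_le_induced]
  refine (hu.2.2 _ (hu.1.inf_induced f) ?_).trans inf_le_right
  rw [nhds_inf, nhds_induced, map_zero, tendsto_inf, tendsto_comap_iff]
  refine ⟨hu.2.1, ?_⟩
  have : f ∘ u = fun _ => 0 := funext hf
  exact this ▸ tendsto_const_nhds

theorem countable_addSubgroup_closure {A : Type*} [AddCommGroup A] {s : Set A} (hs : s.Countable) :
    Countable (AddSubgroup.closure s) := by
  have := hs.to_subtype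
  let p : (s →₀ ℤ) →+ A := Finsupp.liftAddHom fun c => zmultiplesHom A c.1
  have hle : AddSubgroup.closure s ≤ p.range :=
    (AddSubgroup.closure_le _).2 fun c hc => ⟨Finsupp.single ⟨c, hc⟩ 1, by simp [p]⟩
  exact ((Set.countable_range p).mono hle).to_subtype

/-- Every countable abelian group embeds into a countable divisible abelian group. -/
theorem exists_injective_countable_baer.{v} (C : Type v) [AddCommGroup C] [Countable C] :
    ∃ (D : Type v) (_ : AddCommGroup D) (i : C →+ D),
      Countable D ∧ Module.Baer ℤ D ∧ Function.Injective i := by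
  let p : (C →₀ ℤ) →+ C := Finsupp.liftAddHom fun c => zmultiplesHom C c
  let ι : (C →₀ ℤ) →+ (C →₀ ℚ) := Finsupp.mapRange.addMonoidHom (Int.castAddHom ℚ)
  have hι : Function.Injective ι := Finsupp.mapRange_injective _ (by simp) Int.cast_injective
  have hι1 : ∀ c, ι (Finsupp.single c 1) = Finsupp.single c 1 := fun c => by simp [ι]
  have hp1 : ∀ c, p (Finsupp.single c 1) = c := fun c => by simp [p]
  -- The relations of the free presentation of `C`, viewed with rational coefficients: the quotient
  -- is divisible and contains `C`.
  let R : AddSubgroup (C →₀ ℚ) := p.ker.map ι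
  have hadd : ∀ a b : C, (QuotientAddGroup.mk (Finsupp.single (a + b) 1) : (C →₀ ℚ) ⧸ R) =
      QuotientAddGroup.mk (Finsupp.single a 1) + QuotientAddGroup.mk (Finsupp.single b 1) := by
    intro a b
    rw [← QuotientAddGroup.mk_add, QuotientAddGroup.eq]
    exact ⟨-Finsupp.single (a + b) 1 + (Finsupp.single a 1 + Finsupp.single b 1),
      by simp [AddMonoidHom.mem_ker, hp1], by simp [hι1]⟩
  refine ⟨(C →₀ ℚ) ⧸ R, inferInstance,
    AddMonoidHom.mk' (fun c => QuotientAddGroup.mk (Finsupp.single c 1)) hadd,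
    (QuotientAddGroup.mk_surjective (s := R)).countable, ?_, ?_⟩
  · let : DivisibleBy (C →₀ ℚ) ℤ := divisibleByOfSMulRightSurj (C →₀ ℚ) ℤ fun {n} hn x =>
      ⟨(n : ℚ)⁻¹ • x, by
        have : (n : ℚ) ≠ 0 := by exact_mod_cast hn
        ext c
        simp [this]⟩
    let : DivisibleBy (C →₀ ℚ) ℕ := AddGroup.divisibleByNatOfDivisibleByInt _
    let : DivisibleBy ((C →₀ ℚ) ⧸ R) ℤ := AddGroup.divisibleByIntOfDivisibleByNat _
    exact Module.Baer.of_divisible _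
  · intro a b hab
    obtain ⟨k, hk, hk'⟩ := QuotientAddGroup.eq.1 hab
    have : k = -Finsupp.single a 1 + Finsupp.single b 1 := hι (by simp [hk', hι1])
    rw [this] at hk
    simpa [AddMonoidHom.mem_ker, hp1, neg_add_eq_zero] using hk

/-- Every infinite abelian group has a countably infinite homomorphic image. -/
theorem exists_addMonoidHom_countable_infinite_range.{v} (A : Type v) [AddCommGroup A] [Infinite A] :
    ∃ (D : Type v) (_ : AddCommGroup D) (f : A →+ D), Countable D ∧ Infinite f.range := by
  let C := AddSubgroup.closure (Set.range (Infinite.natEmbedding A))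
  have hinf : Infinite C := Infinite.of_injective
    (fun n => (⟨Infinite.natEmbedding A n, AddSubgroup.subset_closure ⟨n, rfl⟩⟩ : C))
    fun m n h => (Infinite.natEmbedding A).injective (congrArg Subtype.val h)
  have : Countable C := countable_addSubgroup_closure (Set.countable_range _)
  obtain ⟨D, _, i, hD, hBaer, hi⟩ := exists_injective_countable_baer C
  -- Injectivity of `D` extends the embedding of `C` to all of `A`, keeping the target countable.
  obtain ⟨f, hf⟩ := hBaer.extension_property_addMonoidHom C.subtype C.subtype_injective i
  refine ⟨D, inferInstance, f, hD, Infinite.of_injective (fun c : C => (⟨f c, c, rfl⟩ : f.range))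
    fun a b h => hi ?_⟩
  rw [← hf]
  exact congrArg Subtype.val h

/-- Characters of an abelian group with values in the circle separate points. -/
theorem exists_addMonoidHom_unitAddCircle_ne_zero {B : Type*} [AddCommGroup B] {b : B}
    (hb : b ≠ 0) : ∃ χ : B →+ UnitAddCircle, χ b ≠ 0 := by
  obtain ⟨c, hc⟩ := CharacterModule.exists_character_apply_ne_zero_of_ne_zero hb
  -- `ℚ/ℤ` embeds in `ℝ/ℤ`, which is compact.
  let j : AddCircle (1 : ℚ) →+ UnitAddCircle :=
    QuotientAddGroup.map _ _ (Rat.castHom ℝ).toAddMonoidHom (by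
      rintro _ ⟨n, rfl⟩
      exact ⟨n, by simp⟩)
  have hj : ∀ x, j x = 0 → x = 0 := by
    intro x
    induction x using QuotientAddGroup.induction_on with
    | H q =>
      intro h
      obtain ⟨n, hn⟩ := (QuotientAddGroup.eq_zero_iff _).1 h
      refine (QuotientAddGroup.eq_zero_iff _).2 ⟨n, ?_⟩
      have : (n : ℝ) = (q : ℝ) := by simpa using hn
      have : (n : ℚ) = q := by exact_mod_cast this
      simpa using this
  exact ⟨j.comp (c : B →+ AddCircle (1 : ℚ)), fun h => hc (hj _ h)⟩

/-- The sequence characterizing a pseudocompact group generates a subgroup of finite index. -/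
theorem Characterizes.finite_quotient_closure {G : Type*} [AddCommGroup G] [τ : TopologicalSpace G]
    (hG : IsPseudocompact G) {u : ℕ → G} (hu : Characterizes u τ) :
    Finite (G ⧸ AddSubgroup.closure (Set.range u)) := by
  by_contra h
  rw [not_finite_iff_infinite] at h
  obtain ⟨D, _, f, hD, hf⟩ :=
    exists_addMonoidHom_countable_infinite_range (G ⧸ AddSubgroup.closure (Set.range u))
  choose χ hχ using fun d : {d : D // d ≠ 0} => exists_addMonoidHom_unitAddCircle_ne_zero d.2
  let Φ : D →+ ({d : D // d ≠ 0} → UnitAddCircle) := AddMonoidHom.pi χ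
  have hΦ : Function.Injective Φ := (injective_iff_map_eq_zero Φ).2 fun d hd => by
    by_contra hd0
    exact hχ ⟨d, hd0⟩ (congrFun hd ⟨d, hd0⟩)
  let Ψ := (Φ.comp f).comp (QuotientAddGroup.mk' (AddSubgroup.closure (Set.range u)))
  have hΨ : Continuous Ψ := hu.continuous_of_forall_eq_zero Ψ fun n => by
    have : QuotientAddGroup.mk' (AddSubgroup.closure (Set.range u)) (u n) = 0 :=
      (QuotientAddGroup.eq_zero_iff _).2 (AddSubgroup.subset_closure ⟨n, rfl⟩)
    simp only [Ψ, AddMonoidHom.comp_apply, this, map_zero]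
  have hmem : ∀ d : f.range, Φ d ∈ Ψ.range := by
    rintro ⟨_, a, rfl⟩
    obtain ⟨g, rfl⟩ := QuotientAddGroup.mk'_surjective _ a
    exact ⟨g, rfl⟩
  have hcount : Countable Ψ.range := by
    have : (Set.range Ψ).Countable := (Set.countable_range Φ).mono <| by
      rintro _ ⟨g, rfl⟩
      exact ⟨_, rfl⟩
    exact this.to_subtype
  have hfin : Finite Ψ.range :=
    (hG.of_surjective (f := Ψ.rangeRestrict) (hΨ.subtype_mk _)
      Ψ.rangeRestrict_surjective).finite_of_countable
  exact hf.not_finite (Finite.of_injective (fun d : f.range => (⟨Φ d, hmem d⟩ : Ψ.range))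
    fun a b hab => Subtype.ext (hΦ (congrArg Subtype.val hab)))

/-- A finite Hausdorff space is discrete, so its topology is finer than any other and the zero
sequence suffices. -/
theorem isSSCharacterized_of_finite (G : Type*) [AddCommGroup G] [τ : TopologicalSpace G]
    [IsTopologicalAddGroup G] [T2Space G] [Finite G] : IsSSCharacterized G := by
  have hd : DiscreteTopology G := inferInstance
  refine ⟨fun _ => 0, ⟨inferInstance, inferInstance, fun U hU => ⟨Set.univ, Set.finite_univ, ?_⟩⟩,
    tendsto_const_nhds, fun σ _ _ => ?_⟩
  · exact Set.eq_univ_of_forall fun x =>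
      Set.mem_add.2 ⟨x, Set.mem_univ x, 0, mem_of_mem_nhds hU, add_zero x⟩
  · exact hd.eq_bot.trans_le bot_le

theorem corollaryC1 {G : Type*} [AddCommGroup G] [TopologicalSpace G] [IsTopologicalAddGroup G]
    [T2Space G] (hG : IsPseudocompact G) : IsSSCharacterized G ↔ Finite G := by
  refine ⟨fun ⟨u, hu⟩ => ?_, fun _ => isSSCharacterized_of_finite G⟩
  have := hu.finite_quotient_closure hG
  have := countable_addSubgroup_closure (Set.countable_range u)
  have : Countable G :=
    AddSubgroup.addGroupEquivQuotientProdAddSubgroup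
      (s := AddSubgroup.closure (Set.range u)) |>.countable_iff.2 inferInstance
  exact hG.finite_of_countable
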